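/- **Theorem 3.2 (online Tusnády problem).** For every $d\ge 1$ there is a constant $C_d>0$, depending only on $d$, such that the following holds. Let $t\ge 1$ be an integer, let $\delta\in(0,1)$ with $dt/\delta\ge 2$ (so for $dt\ge 2$ every $\delta\in(0,1)$ is allowed), and let $\mathfrak p$ be any Borel probability distribution on $[0,1]^d$. Then there is a randomized online algorithm (which may depend on $d$, $t$, $\delta$ and $\mathfrak p$) that assigns signs $\varepsilon_1,\dots,\varepsilon_t\in\{-1,1\}$ to points $x_1,\dots,x_t$ drawn independently from $\mathfrak p$, where $\varepsilon_i$ is determined by $x_1,\dots,x_i$ and by an internal random source independent of all the points, such that with probability at least $1-\delta$, over the points and the internal randomness, $$\left|\sum_{j=1}^{i}\varepsilon_j\,\mathbf 1_B(x_j)\right|\;\le\; C_d\,\log^{d+1}\!\left(\frac{dt}{\delta}\right)$$ simultaneously for all $i\in\{1,\dots,t\}$ and all axis-parallel boxes $B\subseteq[0,1]^d$ (products of intervals, each of any type). -/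

import Mathlib

open MeasureTheory

/-- A randomized online algorithm that assigns signs to `t` points of `X` arriving one at a time.
All random choices are read off a random seed `s : Ω`, drawn independently of the points, and the
sign of the `i`-th point is chosen on seeing only the seed and the points that have arrived so far,
so that neither later points nor later decisions can influence it. -/
structure OnlineSigning (Ω X : Type) [MeasurableSpace Ω] [MeasurableSpace X] (t : ℕ) where
  /-- `sign s x i` is the sign given to the point `x i` when the seed is `s`. -/
  sign : Ω → (Fin t → X) → Fin t → ℝ
  sign_eq : ∀ s x i, sign s x i = 1 ∨ sign s x i = -1
  online : ∀ s x y i, (∀ j, j ≤ i → x j = y j) → sign s x i = sign s y i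
  measurable_sign : ∀ i, Measurable fun q : Ω × (Fin t → X) => sign q.1 q.2 i

/-- An axis-parallel box in `[0,1]^d`: a product of intervals. The order-connected subsets of `[0,1]`
are exactly its intervals: open, closed, half-open, degenerate or empty. -/
def IsBox {d : ℕ} (B : Set (Fin d → unitInterval)) : Prop :=
  ∃ I : Fin d → Set unitInterval, (∀ k, (I k).OrdConnected) ∧ B = Set.univ.pi I

/-- The discrepancy `|ε₁ 1_B(x₁) + ⋯ + εᵢ 1_B(xᵢ)|` of the set `B` after the `i`-th point. -/
noncomputable def prefixDisc {X : Type} {t : ℕ} (ε : Fin t → ℝ) (x : Fin t → X) (B : Set X)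
    (i : Fin t) : ℝ :=
  |∑ j ∈ Finset.Iic i, ε j * B.indicator (fun _ => (1 : ℝ)) (x j)|

/-!
The signs come from the self-balancing walk of Alweiss, Liu and Sawhney, run on vectors that encode
the position of a point among dyadic boxes.

*The walk.* If `w` is the sum of the signed vectors so far and `v` the next vector, the sign `1` is
chosen with probability `1/2 - ⟪w, v⟫/(2c)`. By Hoeffding's lemma the average of
`exp ⟪w ± v, u⟫` over the new sign is at most `exp (⟪w, u - (⟪v, u⟫/c) v⟫ + ⟪v, u⟫²/2)`, and the
decrease of the squared norm from `u` to `u - (⟪v, u⟫/c) v` pays for the last term when `‖v‖² ≤ c`.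
Hence by induction `E exp ⟪w, u⟫ ≤ exp (c‖u‖²/2)` for all `u` at all times
(`lintegral_exp_walk_le`), where the expectation is over the event that all `|⟪w, v⟫|` so far were
at most `c`, so that the probabilities made sense. Gaussian tails and a union bound, used with
`u = v` for this event and with the test vectors `u` otherwise, control the walk in finitely many
directions (`measure_exists_walk_large_le`). The vectors are arbitrary here; only the seed is random.

*Discretisation.* Each axis is cut into the quantile cells of the marginal distribution with mesh
`1/N`, where `N` is of order `d t²/δ`. With probability at least `1 - δ/2` no two of the points have
different `k`-th coordinates in the same cell for any `k` (`measure_cellCollision_le`), and then a box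
contains the same points as some box of cells (`exists_label_interval`).

*Encoding.* On `L = O(log (dt/δ))` dyadic levels, a cell `c` is encoded by the dyadic intervals
containing it, and `[0, r)` by the dyadic intervals read off the binary digits of `r`. The inner
product of the two is the indicator of `c < r`, and both have squared norm at most `L`. Tensor
products over the coordinates encode points by vectors with squared norm at most `L ^ d` and boxes
by vectors with squared norm at most `(4 L) ^ d` (`inner_pointVector_boxVector`), so that the
discrepancy of a box is the inner product of the walk with its encoding. With `c` of order
`L ^ d log (dt/δ)` the sub-Gaussian tail, together with a union bound over the `2 ^ (2 L d)` boxes of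
cells and the `t` times, gives a discrepancy of order
`√(c (4 L) ^ d log (dt/δ)) = O(log (dt/δ) ^ (d + 1))`.
-/

/-! ### The self-balancing walk -/

section Walk

open scoped RealInnerProductSpace

/-- The sign used by the self-balancing walk with parameter `c` when the current position has inner
product `z` with the new vector and the fresh uniform random number is `y`: for `|z| ≤ c` it is `1`
with probability `1/2 - z/(2c)`, so that its mean `-z/c` pushes the walk back. -/
noncomputable def balancedSign (c : ℝ) (y : unitInterval) (z : ℝ) : ℝ :=
  if (y : ℝ) ≤ 1 / 2 - z / (2 * c) then 1 else -1

lemma balancedSign_eq (c : ℝ) (y : unitInterval) (z : ℝ) :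
    balancedSign c y z = 1 ∨ balancedSign c y z = -1 := by
  unfold balancedSign
  split_ifs <;> simp

lemma measurable_balancedSign (c : ℝ) :
    Measurable fun q : unitInterval × ℝ => balancedSign c q.1 q.2 := by
  unfold balancedSign
  refine Measurable.ite (measurableSet_le ?_ ?_) measurable_const measurable_const <;> fun_prop

lemma integral_balancedSign {c z : ℝ} (hc : 0 < c) (hz : |z| ≤ c) :
    ∫ y : unitInterval, balancedSign c y z = -z / c := by
  obtain ⟨h1, h2⟩ := abs_le.1 hz
  have hzc : z / (2 * c) ≤ 1 / 2 := by rw [div_le_iff₀ (by positivity)]; linarith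
  have hzc' : -(1 / 2) ≤ z / (2 * c) := by rw [le_div_iff₀ (by positivity)]; linarith
  set q : unitInterval := ⟨1 / 2 - z / (2 * c), by linarith, by linarith⟩ with hq
  have : (fun y : unitInterval => balancedSign c y z)
      = fun y => (Set.Iic q).indicator (fun _ => (2 : ℝ)) y - 1 := by
    ext y
    by_cases h : y ≤ q
    · have h' : (y : ℝ) ≤ 1 / 2 - z / (2 * c) := h
      rw [Set.indicator_of_mem (Set.mem_Iic.2 h), balancedSign, if_pos h']
      norm_num
    · have h' : ¬ (y : ℝ) ≤ 1 / 2 - z / (2 * c) := h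
      rw [Set.indicator_of_notMem (by simpa using h), balancedSign, if_neg h']
      norm_num
  rw [this, integral_sub ((integrable_const _).indicator measurableSet_Iic) (integrable_const _),
    integral_indicator measurableSet_Iic]
  have hvol : volume.real (Set.Iic q) = (q : ℝ) := by
    rw [measureReal_def, unitInterval.volume_Iic, ENNReal.toReal_ofReal q.2.1]
  rw [setIntegral_const, integral_const, hvol, probReal_univ, hq]
  simp only [smul_eq_mul]
  field_simp
  ring

/-- Hoeffding's lemma for the random sign of the walk. -/
lemma lintegral_exp_balancedSign_le {c z : ℝ} (hc : 0 < c) (hz : |z| ≤ c) (a b : ℝ) :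
    ∫⁻ y : unitInterval, ENNReal.ofReal (Real.exp (a + balancedSign c y z * b))
      ≤ ENNReal.ofReal (Real.exp (a - z * b / c + b ^ 2 / 2)) := by
  have hm : Measurable fun y : unitInterval => balancedSign c y z :=
    (measurable_balancedSign c).comp (measurable_id.prodMk measurable_const)
  have hb : ∀ y : unitInterval, balancedSign c y z ∈ Set.Icc (-1 : ℝ) 1 := fun y => by
    rcases balancedSign_eq c y z with h | h <;> rw [h] <;> norm_num
  have hH := (ProbabilityTheory.hasSubgaussianMGF_of_mem_Icc (μ := (volume : Measure unitInterval))
    hm.aemeasurable (Filter.Eventually.of_forall hb))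
  have h1 := hH.mgf_le b
  have hi := hH.integrable_exp_mul b
  rw [integral_balancedSign hc hz] at h1 hi
  have heq : ∀ y : unitInterval, Real.exp (a + balancedSign c y z * b)
      = Real.exp (a - z * b / c) * Real.exp (b * (balancedSign c y z - -z / c)) := fun y => by
    rw [← Real.exp_add]; congr 1; ring
  rw [← ofReal_integral_eq_lintegral_ofReal]
  · refine ENNReal.ofReal_le_ofReal ?_
    simp_rw [heq]
    rw [integral_const_mul, Real.exp_add]
    refine mul_le_mul_of_nonneg_left ?_ (Real.exp_pos _).le
    refine h1.trans (Real.exp_le_exp.2 (le_of_eq ?_))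
    norm_num
  · simp_rw [heq]
    exact hi.const_mul _
  · exact Filter.Eventually.of_forall fun y => (Real.exp_pos _).le

variable {H : Type*} [NormedAddCommGroup H] [InnerProductSpace ℝ H] {t : ℕ}

/-- The position of the self-balancing walk after `n` steps: the signed sum of the first `n` of the
vectors `v`, each sign being chosen from the current position with the help of the seed `s`. The
walk stays put from time `t` on. -/
noncomputable def walk (c : ℝ) (s : Fin t → unitInterval) (v : Fin t → H) : ℕ → H
  | 0 => 0
  | n + 1 =>
    if h : n < t then
      walk c s v n + balancedSign c (s ⟨n, h⟩) ⟪walk c s v n, v ⟨n, h⟩⟫ • v ⟨n, h⟩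
    else walk c s v n

/-- The sign given by the self-balancing walk to the `i`-th vector. -/
noncomputable def walkSign (c : ℝ) (s : Fin t → unitInterval) (v : Fin t → H) (i : Fin t) : ℝ :=
  balancedSign c (s i) ⟪walk c s v i, v i⟫

lemma walk_succ (c : ℝ) (s : Fin t → unitInterval) (v : Fin t → H) (i : Fin t) :
    walk c s v (i + 1) = walk c s v i + walkSign c s v i • v i := by
  rw [walk, dif_pos i.2]
  rfl

lemma walk_congr {c : ℝ} {s s' : Fin t → unitInterval} {v v' : Fin t → H} {n : ℕ}
    (h : ∀ j : Fin t, (j : ℕ) < n → s j = s' j ∧ v j = v' j) :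
    walk c s v n = walk c s' v' n := by
  induction n with
  | zero => rfl
  | succ n ih =>
    have ih' := ih fun j hj => h j (hj.trans n.lt_succ_self)
    rw [walk, walk, ih']
    split_ifs with hn
    · obtain ⟨h1, h2⟩ := h ⟨n, hn⟩ n.lt_succ_self
      rw [h1, h2]
    · rfl

lemma walk_succ_eq_sum (c : ℝ) (s : Fin t → unitInterval) (v : Fin t → H) (i : Fin t) :
    walk c s v (i + 1) = ∑ j ∈ Finset.Iic i, walkSign c s v j • v j := by
  obtain ⟨n, hn⟩ := i
  induction n with
  | zero =>
    have : Finset.Iic (⟨0, hn⟩ : Fin t) = {⟨0, hn⟩} := by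
      ext j; simp [Fin.le_def, Fin.ext_iff]
    rw [walk_succ, this, Finset.sum_singleton]
    simp [walk]
  | succ n ih =>
    have : Finset.Iic (⟨n + 1, hn⟩ : Fin t)
        = insert ⟨n + 1, hn⟩ (Finset.Iic ⟨n, n.lt_succ_self.trans hn⟩) := by
      ext j; simp [Fin.le_def, Fin.ext_iff]; omega
    rw [walk_succ, this, Finset.sum_insert (by simp [Fin.le_def]),
      ← ih (n.lt_succ_self.trans hn), add_comm]

/-- Up to time `n` no inner product of the walk with an incoming vector exceeds `c` in absolute
value, so that all the numbers `1/2 - z/(2c)` are genuine probabilities. -/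
def WalkSafe (c : ℝ) (s : Fin t → unitInterval) (v : Fin t → H) (n : ℕ) : Prop :=
  ∀ j : Fin t, (j : ℕ) < n → |⟪walk c s v j, v j⟫| ≤ c

lemma walkSafe_congr {c : ℝ} {s s' : Fin t → unitInterval} {v : Fin t → H} {n : ℕ}
    (h : ∀ j : Fin t, (j : ℕ) + 1 < n → s j = s' j) (hs : WalkSafe c s v n) :
    WalkSafe c s' v n := fun j hj => by
  rw [← walk_congr (s := s) fun k hk => ⟨h k (by omega), rfl⟩]
  exact hs j hj

section Measurability

variable [MeasurableSpace H] [BorelSpace H] [SecondCountableTopology H]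

lemma measurable_walk (c : ℝ) (n : ℕ) :
    Measurable fun q : (Fin t → unitInterval) × (Fin t → H) => walk c q.1 q.2 n := by
  induction n with
  | zero => exact measurable_const
  | succ n ih =>
    simp only [walk]
    split_ifs with h
    · have hv : Measurable fun q : (Fin t → unitInterval) × (Fin t → H) => q.2 ⟨n, h⟩ := by fun_prop
      have hs : Measurable fun q : (Fin t → unitInterval) × (Fin t → H) => q.1 ⟨n, h⟩ := by fun_prop
      exact ih.add (((measurable_balancedSign c).comp (hs.prodMk (ih.inner hv))).smul hv)
    · exact ih

lemma measurable_walkSign (c : ℝ) (i : Fin t) :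
    Measurable fun q : (Fin t → unitInterval) × (Fin t → H) => walkSign c q.1 q.2 i := by
  have hv : Measurable fun q : (Fin t → unitInterval) × (Fin t → H) => q.2 i := by fun_prop
  have hs : Measurable fun q : (Fin t → unitInterval) × (Fin t → H) => q.1 i := by fun_prop
  exact (measurable_balancedSign c).comp (hs.prodMk ((measurable_walk c i).inner hv))

lemma measurable_walk_left (c : ℝ) (v : Fin t → H) (n : ℕ) :
    Measurable fun s : Fin t → unitInterval => walk c s v n :=
  (measurable_walk c n).comp (measurable_id.prodMk measurable_const)

lemma measurableSet_walkSafe (c : ℝ) (v : Fin t → H) (n : ℕ) :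
    MeasurableSet {s : Fin t → unitInterval | WalkSafe c s v n} := by
  have : {s : Fin t → unitInterval | WalkSafe c s v n}
      = ⋂ j : Fin t, ⋂ _ : (j : ℕ) < n, {s | |⟪walk c s v j, v j⟫| ≤ c} := by
    ext s; simp [WalkSafe]
  rw [this]
  refine MeasurableSet.iInter fun j => MeasurableSet.iInter fun _ => ?_
  have h : Measurable fun s : Fin t → unitInterval => ⟪walk c s v j, v j⟫ :=
    (measurable_walk_left c v j).inner measurable_const
  exact measurableSet_le h.abs measurable_const

end Measurability

/-- Removing a `1/c` fraction of the component along `v` shrinks the squared norm by enough to pay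
for the fresh random sign. -/
lemma norm_sq_sub_smul_le {c : ℝ} (hc : 0 < c) (u v : H) (hv : ‖v‖ ^ 2 ≤ c) :
    c * ‖u - (⟪v, u⟫ / c) • v‖ ^ 2 ≤ c * ‖u‖ ^ 2 - ⟪v, u⟫ ^ 2 := by
  rw [norm_sub_sq_real, inner_smul_right, norm_smul, mul_pow, Real.norm_eq_abs, sq_abs,
    real_inner_comm v u]
  set b := ⟪v, u⟫
  have h1 : (b / c) ^ 2 * ‖v‖ ^ 2 ≤ (b / c) ^ 2 * c := by gcongr
  have h2 : c * ((b / c) ^ 2 * c) = b ^ 2 := by field_simp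
  have h3 : c * (b / c * b) = b ^ 2 := by field_simp
  nlinarith [mul_le_mul_of_nonneg_left h1 hc.le]

variable [MeasurableSpace H] [BorelSpace H] [SecondCountableTopology H]

/-- **Sub-Gaussianity of the self-balancing walk**: in every direction, and as long as it is safe,
the walk has exponential moments bounded by those of a Gaussian of variance `c`, whatever the number
of steps. The average over the last sign replaces the test vector `u` by
`u - (⟪v, u⟫ / c) • v`, and the loss in Hoeffding's lemma is paid for by the decrease of the norm. -/
theorem lintegral_exp_walk_le {c : ℝ} (hc : 0 < c) (v : Fin t → H) (hv : ∀ i, ‖v i‖ ^ 2 ≤ c)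
    (n : ℕ) (u : H) :
    ∫⁻ s, Set.indicator {s | WalkSafe c s v n}
        (fun s => ENNReal.ofReal (Real.exp ⟪walk c s v n, u⟫)) s
        ∂(Measure.pi fun _ : Fin t => (volume : Measure unitInterval))
      ≤ ENNReal.ofReal (Real.exp (c * ‖u‖ ^ 2 / 2)) := by
  induction n generalizing u with
  | zero =>
    refine (lintegral_mono (Set.indicator_le_self _ _)).trans ?_
    simp only [walk, inner_zero_left, Real.exp_zero, ENNReal.ofReal_one, lintegral_const,
      measure_univ, mul_one]
    rw [← ENNReal.ofReal_one]
    exact ENNReal.ofReal_le_ofReal (Real.one_le_exp (by positivity))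
  | succ n ih =>
    by_cases hn : n < t
    swap
    · refine le_trans (lintegral_mono fun s => ?_) (ih u)
      simp only [walk, dif_neg hn]
      have hsub : {s | WalkSafe c s v (n + 1)} ⊆ {s | WalkSafe c s v n} :=
        by
        intro s (hs : WalkSafe c s v (n + 1)) j hj
        exact hs j (hj.trans n.lt_succ_self)
      exact Set.indicator_le_indicator_of_subset hsub (fun _ => zero_le) s
    set i : Fin t := ⟨n, hn⟩ with hi
    set b := ⟪v i, u⟫ with hb
    set u' := u - (b / c) • v i with hu'
    have hmeas : ∀ m (w : H), Measurable fun s : Fin t → unitInterval =>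
        Set.indicator {s | WalkSafe c s v m}
          (fun s => ENNReal.ofReal (Real.exp ⟪walk c s v m, w⟫)) s := fun m w => by
      refine Measurable.indicator ?_ (measurableSet_walkSafe c v m)
      exact (Real.measurable_exp.comp
        ((measurable_walk_left c v m).inner measurable_const)).ennreal_ofReal
    have key : ∫⁻ s, Set.indicator {s | WalkSafe c s v (n + 1)}
          (fun s => ENNReal.ofReal (Real.exp ⟪walk c s v (n + 1), u⟫)) s
          ∂(Measure.pi fun _ : Fin t => (volume : Measure unitInterval))
        ≤ ∫⁻ s, Set.indicator {s | WalkSafe c s v n}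
          (fun s => ENNReal.ofReal (Real.exp ⟪walk c s v n, u'⟫)) s
            * ENNReal.ofReal (Real.exp (b ^ 2 / 2))
          ∂(Measure.pi fun _ : Fin t => (volume : Measure unitInterval)) := by
      refine lintegral_le_of_lmarginal_le {i} (hmeas _ _) ((hmeas _ _).mul_const _) ?_
      rw [lmarginal_singleton, lmarginal_singleton]
      intro s
      have hup : ∀ y : unitInterval, ∀ j : Fin t, (j : ℕ) < n → Function.update s i y j = s j :=
        fun y j hj => Function.update_of_ne (fun h => by simp [h, hi] at hj) _ _
      have hwalk : ∀ y, walk c (Function.update s i y) v n = walk c s v n := fun y =>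
        walk_congr fun j hj => ⟨hup y j hj, rfl⟩
      have hsafe : ∀ y, ∀ m ≤ n + 1,
          WalkSafe c (Function.update s i y) v m ↔ WalkSafe c s v m := fun y m hm =>
        ⟨walkSafe_congr fun j hj => hup y j (by omega),
          walkSafe_congr fun j hj => (hup y j (by omega)).symm⟩
      have hR : ∀ y, Set.indicator {s | WalkSafe c s v n}
          (fun s => ENNReal.ofReal (Real.exp ⟪walk c s v n, u'⟫)) (Function.update s i y)
          = Set.indicator {s | WalkSafe c s v n}
          (fun s => ENNReal.ofReal (Real.exp ⟪walk c s v n, u'⟫)) s := fun y => by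
        by_cases h : WalkSafe c s v n
        · rw [Set.indicator_of_mem (show s ∈ {s | WalkSafe c s v n} from h),
            Set.indicator_of_mem (show Function.update s i y ∈ {s | WalkSafe c s v n} from
              (hsafe y n n.le_succ).2 h), hwalk]
        · rw [Set.indicator_of_notMem (show s ∉ {s | WalkSafe c s v n} from h),
            Set.indicator_of_notMem (show Function.update s i y ∉ {s | WalkSafe c s v n} from
              fun h' => h ((hsafe y n n.le_succ).1 h'))]
      simp only [hR, lintegral_const, measure_univ, mul_one]
      by_cases hs : WalkSafe c s v (n + 1)
      · have hs' : WalkSafe c s v n := fun j hj => hs j (hj.trans n.lt_succ_self)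
        have hz : |⟪walk c s v n, v i⟫| ≤ c := hs i n.lt_succ_self
        rw [Set.indicator_of_mem (show s ∈ {s | WalkSafe c s v n} from hs'),
          ← ENNReal.ofReal_mul (Real.exp_pos _).le, ← Real.exp_add]
        have hL : ∀ y, Set.indicator {s | WalkSafe c s v (n + 1)}
            (fun s => ENNReal.ofReal (Real.exp ⟪walk c s v (n + 1), u⟫)) (Function.update s i y)
            = ENNReal.ofReal (Real.exp (⟪walk c s v n, u⟫
              + balancedSign c y ⟪walk c s v n, v i⟫ * b)) := fun y => by
          rw [Set.indicator_of_mem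
            (show _ ∈ {s | WalkSafe c s v (n + 1)} from (hsafe y _ le_rfl).2 hs)]
          have h := walk_succ c (Function.update s i y) v i
          rw [walkSign, Function.update_self, show (i : ℕ) = n from rfl, hwalk] at h
          rw [h, inner_add_left, real_inner_smul_left]
        simp_rw [hL]
        refine (lintegral_exp_balancedSign_le hc hz _ _).trans (le_of_eq ?_)
        congr 3
        rw [hu', inner_sub_right, inner_smul_right]
        ring
      · have hL : ∀ y, Set.indicator {s | WalkSafe c s v (n + 1)}
            (fun s => ENNReal.ofReal (Real.exp ⟪walk c s v (n + 1), u⟫)) (Function.update s i y)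
            = 0 := fun y => Set.indicator_of_notMem (fun h => hs ((hsafe y _ le_rfl).1 h)) _
        simp only [hL, lintegral_zero, zero_le]
    refine key.trans ?_
    rw [lintegral_mul_const _ (hmeas _ _)]
    refine (mul_le_mul_left (ih u') _).trans ?_
    rw [← ENNReal.ofReal_mul (Real.exp_pos _).le, ← Real.exp_add]
    refine ENNReal.ofReal_le_ofReal (Real.exp_le_exp.2 ?_)
    have := norm_sq_sub_smul_le hc u (v i) (hv i)
    linarith

/-- Gaussian tail bound for the walk in a fixed direction. -/
lemma measure_walk_tail_le {c : ℝ} (hc : 0 < c) (v : Fin t → H) (hv : ∀ i, ‖v i‖ ^ 2 ≤ c)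
    (n : ℕ) {u : H} {U τ : ℝ} (hU : 0 < U) (hu : ‖u‖ ^ 2 ≤ U) (hτ : 0 ≤ τ) :
    (Measure.pi fun _ : Fin t => (volume : Measure unitInterval))
        {s | WalkSafe c s v n ∧ τ < |⟪walk c s v n, u⟫|}
      ≤ ENNReal.ofReal (2 * Real.exp (-(τ ^ 2 / (2 * c * U)))) := by
  have one_sided : ∀ w : H, ‖w‖ ^ 2 ≤ U →
      (Measure.pi fun _ : Fin t => (volume : Measure unitInterval))
        {s | WalkSafe c s v n ∧ τ < ⟪walk c s v n, w⟫}
      ≤ ENNReal.ofReal (Real.exp (-(τ ^ 2 / (2 * c * U)))) := by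
    intro w hw
    -- the exponent that optimises the Chernoff bound
    set r := τ / (c * U) with hr
    have hr0 : 0 ≤ r := by positivity
    set f : (Fin t → unitInterval) → ENNReal := Set.indicator {s | WalkSafe c s v n}
        (fun s => ENNReal.ofReal (Real.exp ⟪walk c s v n, r • w⟫)) with hf
    have hmeas : Measurable f := by
      refine Measurable.indicator ?_ (measurableSet_walkSafe c v n)
      exact (Real.measurable_exp.comp
        ((measurable_walk_left c v n).inner measurable_const)).ennreal_ofReal
    have h1 := mul_meas_ge_le_lintegral (μ := Measure.pi fun _ : Fin t =>
      (volume : Measure unitInterval)) hmeas (ENNReal.ofReal (Real.exp (r * τ)))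
    have h2 := h1.trans (lintegral_exp_walk_le hc v hv n (r • w))
    have hsub : {s | WalkSafe c s v n ∧ τ < ⟪walk c s v n, w⟫}
        ⊆ {s | ENNReal.ofReal (Real.exp (r * τ)) ≤ f s} := by
      rintro s ⟨hs, hw⟩
      change _ ≤ f s
      rw [hf, Set.indicator_of_mem (show s ∈ {s | WalkSafe c s v n} from hs), inner_smul_right]
      exact ENNReal.ofReal_le_ofReal (Real.exp_le_exp.2 (by gcongr))
    refine (measure_mono hsub).trans ?_
    have hpos : 0 < Real.exp (r * τ) := Real.exp_pos _
    rw [← ENNReal.mul_le_mul_iff_right (a := ENNReal.ofReal (Real.exp (r * τ)))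
      (by simpa using hpos) ENNReal.ofReal_ne_top]
    refine h2.trans ?_
    rw [← ENNReal.ofReal_mul hpos.le, ← Real.exp_add]
    refine ENNReal.ofReal_le_ofReal (Real.exp_le_exp.2 ?_)
    rw [norm_smul, mul_pow, Real.norm_eq_abs, sq_abs]
    calc c * (r ^ 2 * ‖w‖ ^ 2) / 2 ≤ c * (r ^ 2 * U) / 2 := by gcongr
      _ = r * τ + -(τ ^ 2 / (2 * c * U)) := by rw [hr]; field_simp; ring
  have hsub : {s | WalkSafe c s v n ∧ τ < |⟪walk c s v n, u⟫|}
      ⊆ {s | WalkSafe c s v n ∧ τ < ⟪walk c s v n, u⟫}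
        ∪ {s | WalkSafe c s v n ∧ τ < ⟪walk c s v n, -u⟫} := by
    rintro s ⟨hs, hw⟩
    rcases lt_abs.1 hw with h | h
    · exact Or.inl ⟨hs, h⟩
    · exact Or.inr ⟨hs, by rwa [inner_neg_right]⟩
  refine (measure_mono hsub).trans ((measure_union_le _ _).trans ?_)
  rw [two_mul, ENNReal.ofReal_add (Real.exp_pos _).le (Real.exp_pos _).le]
  exact add_le_add (one_sided u hu) (one_sided (-u) (by rwa [norm_neg]))

/-- With high probability the walk is small in each of finitely many directions at all times. -/
theorem measure_exists_walk_large_le {κ : Type*} [Fintype κ] {c : ℝ} (hc : 0 < c) (v : Fin t → H)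
    (u : κ → H) {U V τ : ℝ} (hV : 0 < V) (hVc : V ≤ c) (hv : ∀ i, ‖v i‖ ^ 2 ≤ V) (hU : 0 < U)
    (hu : ∀ k, ‖u k‖ ^ 2 ≤ U) (hτ : 0 ≤ τ) :
    (Measure.pi fun _ : Fin t => (volume : Measure unitInterval))
        {s | ∃ (i : Fin t) (k : κ), τ < |⟪walk c s v (i + 1), u k⟫|}
      ≤ ENNReal.ofReal (t * (2 * Real.exp (-(c / (2 * V))))
        + t * Fintype.card κ * (2 * Real.exp (-(τ ^ 2 / (2 * c * U))))) := by
  set P := Measure.pi fun _ : Fin t => (volume : Measure unitInterval)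
  have hvc : ∀ i, ‖v i‖ ^ 2 ≤ c := fun i => (hv i).trans hVc
  have hsub : {s | ∃ (i : Fin t) (k : κ), τ < |⟪walk c s v (i + 1), u k⟫|}
      ⊆ (⋃ i : Fin t, {s | WalkSafe c s v i ∧ c < |⟪walk c s v i, v i⟫|})
        ∪ ⋃ q : Fin t × κ, {s | WalkSafe c s v (q.1 + 1)
            ∧ τ < |⟪walk c s v (q.1 + 1), u q.2⟫|} := by
    rintro s ⟨i, k, hik⟩
    by_cases hs : WalkSafe c s v (i + 1)
    · exact Or.inr (Set.mem_iUnion.2 ⟨(i, k), hs, hik⟩)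
    · left
      -- the walk leaves the safe region for the first time at some step
      have hex : ∃ n : ℕ, ∃ h : n < t, c < |⟪walk c s v n, v ⟨n, h⟩⟫| := by
        simp only [WalkSafe, not_forall, not_le] at hs
        obtain ⟨j, -, hj⟩ := hs
        exact ⟨j, j.2, hj⟩
      classical
      obtain ⟨h, hlt⟩ := Nat.find_spec hex
      refine Set.mem_iUnion.2 ⟨⟨Nat.find hex, h⟩, fun j hj => ?_, hlt⟩
      by_contra hcon
      exact Nat.find_min hex hj ⟨j.2, not_le.1 hcon⟩
  refine (measure_mono hsub).trans ((measure_union_le _ _).trans ?_)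
  rw [ENNReal.ofReal_add (by positivity) (by positivity)]
  refine add_le_add ?_ ?_
  · refine (measure_iUnion_fintype_le _ _).trans ?_
    refine (Finset.sum_le_sum fun (i : Fin t) _ =>
      measure_walk_tail_le hc v hvc (i : ℕ) hV (hv i) hc.le).trans (le_of_eq ?_)
    rw [Finset.sum_const, Finset.card_univ, Fintype.card_fin, nsmul_eq_mul,
      ENNReal.ofReal_mul (Nat.cast_nonneg t), ENNReal.ofReal_natCast]
    congr 5
    field_simp
  · refine (measure_iUnion_fintype_le _ _).trans ?_
    refine (Finset.sum_le_sum fun q _ =>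
      measure_walk_tail_le hc v hvc (q.1 + 1) hU (hu q.2) hτ).trans (le_of_eq ?_)
    rw [Finset.sum_const, Finset.card_univ, Fintype.card_prod, Fintype.card_fin, nsmul_eq_mul,
      ← ENNReal.ofReal_natCast, ← ENNReal.ofReal_mul (by positivity), Nat.cast_mul]

end Walk

/-! ### Quantile cells -/

section Cells

/-- The index of the quantile cell of `a` for the distribution `ν` and mesh `1/N`. It records the
rounded values of the distribution function both at `a` and just below `a`, so that an atom of mass
at least `1/N` has a cell to itself. -/
noncomputable def quantileCell (ν : Measure unitInterval) (N : ℕ) (a : unitInterval) : ℕ :=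
  ⌊N * ν.real (Set.Iio a)⌋₊ + ⌊N * ν.real (Set.Iic a)⌋₊

variable (ν : Measure unitInterval) [IsProbabilityMeasure ν] (N : ℕ)

lemma quantileCell_mono : Monotone (quantileCell ν N) := fun a b hab => by
  unfold quantileCell
  have h1 : ν.real (Set.Iio a) ≤ ν.real (Set.Iio b) :=
    measureReal_mono (Set.Iio_subset_Iio hab)
  have h2 : ν.real (Set.Iic a) ≤ ν.real (Set.Iic b) :=
    measureReal_mono (Set.Iic_subset_Iic.2 hab)
  gcongr

lemma quantileCell_le (a : unitInterval) : quantileCell ν N a ≤ 2 * N := by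
  have h : ∀ S : Set unitInterval, ⌊N * ν.real S⌋₊ ≤ N := fun S => by
    refine Nat.floor_le_of_le ?_
    exact mul_le_of_le_one_right (Nat.cast_nonneg _) measureReal_le_one
  unfold quantileCell
  linarith [h (Set.Iio a), h (Set.Iic a)]

/-- Two different points of one cell span an interval of mass at most `1/N`. -/
lemma measure_Icc_le_of_quantileCell_eq (hN : 0 < N) {a b : unitInterval} (hab : a < b)
    (h : quantileCell ν N a = quantileCell ν N b) :
    ν (Set.Icc a b) ≤ ENNReal.ofReal (1 / N) := by
  have hN' : (0 : ℝ) < N := by exact_mod_cast hN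
  have m1 : ⌊N * ν.real (Set.Iio a)⌋₊ ≤ ⌊N * ν.real (Set.Iic a)⌋₊ :=
    Nat.floor_le_floor (mul_le_mul_of_nonneg_left
      (measureReal_mono Set.Iio_subset_Iic_self) hN'.le)
  have m2 : ⌊N * ν.real (Set.Iic a)⌋₊ ≤ ⌊N * ν.real (Set.Iio b)⌋₊ :=
    Nat.floor_le_floor (mul_le_mul_of_nonneg_left
      (measureReal_mono (Set.Iic_subset_Iio.2 hab)) hN'.le)
  have m3 : ⌊N * ν.real (Set.Iio b)⌋₊ ≤ ⌊N * ν.real (Set.Iic b)⌋₊ :=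
    Nat.floor_le_floor (mul_le_mul_of_nonneg_left
      (measureReal_mono Set.Iio_subset_Iic_self) hN'.le)
  unfold quantileCell at h
  have heq : ⌊N * ν.real (Set.Iio a)⌋₊ = ⌊N * ν.real (Set.Iic b)⌋₊ := by omega
  have h1 : (⌊N * ν.real (Set.Iio a)⌋₊ : ℝ) ≤ N * ν.real (Set.Iio a) :=
    Nat.floor_le (by positivity)
  have h2 : N * ν.real (Set.Iic b) < ⌊N * ν.real (Set.Iic b)⌋₊ + 1 := Nat.lt_floor_add_one _
  rw [← heq] at h2
  have hd : ν.real (Set.Icc a b) = ν.real (Set.Iic b) - ν.real (Set.Iio a) := by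
    rw [← measureReal_sdiff (Set.Iio_subset_Iic hab.le) measurableSet_Iio]
    congr 1
    ext x
    simp
  have : ν.real (Set.Icc a b) ≤ 1 / N := by
    rw [hd, le_div_iff₀ hN']
    nlinarith
  rw [← ofReal_measureReal]
  exact ENNReal.ofReal_le_ofReal this

/-- A random point is unlikely to share its cell with a given different point. -/
lemma measure_quantileCell_eq_le (hN : 0 < N) (x : unitInterval) :
    ν {y | x ≠ y ∧ quantileCell ν N x = quantileCell ν N y} ≤ ENNReal.ofReal (1 / N) := by
  have hm : Measurable (quantileCell ν N) := (quantileCell_mono ν N).measurable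
  set S := {y | x ≠ y ∧ quantileCell ν N x = quantileCell ν N y} with hS
  rcases S.eq_empty_or_nonempty with h0 | ⟨z, hz⟩
  · rw [h0]; simp
  set T := {y | quantileCell ν N y = quantileCell ν N x} with hT
  have hTm : MeasurableSet T := hm (measurableSet_singleton _)
  refine (measure_mono (show S ⊆ T from fun y hy => hy.2.symm)).trans ?_
  rw [hTm.measure_eq_iSup_isCompact_of_ne_top (measure_ne_top _ _)]
  refine iSup_le fun K => iSup_le fun hK => iSup_le fun hKc => ?_
  -- enlarging `K` by two different points of the cell makes its extreme points different
  have hK' : IsCompact (K ∪ {x, z}) := hKc.union (Set.toFinite _).isCompact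
  have hne : (K ∪ {x, z}).Nonempty := ⟨x, by simp⟩
  have hsub : K ∪ {x, z} ⊆ T := by
    rintro y (hy | rfl | rfl)
    · exact hK hy
    · rfl
    · exact hz.2.symm
  obtain ⟨a, ha, hamin⟩ := hK'.exists_isLeast hne
  obtain ⟨b, hb, hbmax⟩ := hK'.exists_isGreatest hne
  have hab : a < b := by
    rcases lt_or_gt_of_ne hz.1 with h | h
    · exact ((hamin (by simp)).trans_lt h).trans_le (hbmax (by simp))
    · exact ((hamin (by simp)).trans_lt h).trans_le (hbmax (by simp))
  refine (measure_mono (show K ⊆ Set.Icc a b from fun y hy =>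
    ⟨hamin (Or.inl hy), hbmax (Or.inl hy)⟩)).trans ?_
  exact measure_Icc_le_of_quantileCell_eq ν N hN hab ((hsub ha).trans (hsub hb).symm)

/-- If a monotone labelling separates the points `X j`, then an interval cuts out of them the same
points as some interval of labels. -/
lemma exists_label_interval {t : ℕ} {X : Fin t → unitInterval} {c : unitInterval → ℕ}
    (hc : Monotone c) {M : ℕ} (hM : ∀ a, c a < M)
    (hX : ∀ i j, c (X i) = c (X j) → X i = X j) {I : Set unitInterval} (hI : I.OrdConnected) :
    ∃ l r : ℕ, l ≤ r ∧ r ≤ M ∧ ∀ j, X j ∈ I ↔ l ≤ c (X j) ∧ c (X j) < r := by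
  classical
  set J : Finset (Fin t) := Finset.univ.filter fun j => X j ∈ I with hJ
  rcases J.eq_empty_or_nonempty with h0 | hne
  · refine ⟨0, 0, le_rfl, Nat.zero_le _, fun j => ?_⟩
    have : j ∉ J := by simp [h0]
    simpa [hJ] using this
  obtain ⟨a, haJ, ha⟩ := J.exists_min_image (fun j => c (X j)) hne
  obtain ⟨b, hbJ, hb⟩ := J.exists_max_image (fun j => c (X j)) hne
  have haI : X a ∈ I := by simpa [hJ] using haJ
  have hbI : X b ∈ I := by simpa [hJ] using hbJ
  refine ⟨c (X a), c (X b) + 1, (ha b hbJ).trans (Nat.le_succ _), hM _, fun j => ⟨fun hj => ?_, ?_⟩⟩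
  · have hjJ : j ∈ J := by simpa [hJ] using hj
    exact ⟨ha j hjJ, Nat.lt_succ_of_le (hb j hjJ)⟩
  · rintro ⟨h1, h2⟩
    have mono : ∀ i k, c (X i) ≤ c (X k) → X i ≤ X k := fun i k hik => by
      by_contra hcon
      have := hX i k (le_antisymm hik (hc (not_le.1 hcon).le))
      exact hcon this.le
    exact hI.out haI hbI ⟨mono a j h1, mono j b (Nat.le_of_lt_succ h2)⟩

variable {d t : ℕ}

/-- Some two of the points `x` differ in some coordinate and still lie in the same quantile cell
there. -/
def CellCollision (c : Fin d → unitInterval → ℕ) (x : Fin t → Fin d → unitInterval) : Prop :=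
  ∃ (i j : Fin t) (k : Fin d), x i k ≠ x j k ∧ c k (x i k) = c k (x j k)

/-- The quantile cells of the `k`-th marginal distribution of `p`. -/
noncomputable def marginalCell (p : Measure (Fin d → unitInterval)) (N : ℕ) (k : Fin d) :
    unitInterval → ℕ :=
  quantileCell (p.map fun a => a k) N

lemma marginalCell_mono (p : Measure (Fin d → unitInterval)) [IsProbabilityMeasure p] (k : Fin d) :
    Monotone (marginalCell p N k) :=
  have := Measure.isProbabilityMeasure_map (μ := p) (measurable_pi_apply k).aemeasurable
  quantileCell_mono _ N

lemma marginalCell_le (p : Measure (Fin d → unitInterval)) [IsProbabilityMeasure p] (k : Fin d)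
    (a : unitInterval) : marginalCell p N k a ≤ 2 * N :=
  have := Measure.isProbabilityMeasure_map (μ := p) (measurable_pi_apply k).aemeasurable
  quantileCell_le _ N a

/-- Collisions have probability at most `d t² / N`, by a union bound over the coordinates and the
pairs of points. -/
lemma measure_cellCollision_le (p : Measure (Fin d → unitInterval)) [IsProbabilityMeasure p]
    (hN : 0 < N) :
    (Measure.pi fun _ : Fin t => p) {x | CellCollision (marginalCell p N) x}
      ≤ ENNReal.ofReal (d * t ^ 2 / N) := by
  have hpr : ∀ k, IsProbabilityMeasure (p.map fun a : Fin d → unitInterval => a k) := fun k =>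
    Measure.isProbabilityMeasure_map (measurable_pi_apply k).aemeasurable
  have hcm : ∀ k, Measurable (marginalCell p N k) := fun k => (marginalCell_mono N p k).measurable
  have pair : ∀ (i j : Fin t) (k : Fin d), (Measure.pi fun _ : Fin t => p)
      {x | x i k ≠ x j k ∧ marginalCell p N k (x i k) = marginalCell p N k (x j k)}
        ≤ ENNReal.ofReal (1 / N) := by
    intro i j k
    by_cases hij : i = j
    · subst hij; simp
    set S : Set (Fin t → Fin d → unitInterval) := {x | x i k ≠ x j k ∧
      marginalCell p N k (x i k) = marginalCell p N k (x j k)} with hS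
    have hxm : ∀ i, Measurable fun x : Fin t → Fin d → unitInterval => x i k := fun i => by fun_prop
    have hSm : MeasurableSet S :=
      (measurableSet_eq_fun (hxm i) (hxm j)).compl.inter
        (measurableSet_eq_fun ((hcm k).comp (hxm i)) ((hcm k).comp (hxm j)))
    have hone : ∫⁻ _x, ENNReal.ofReal (1 / N) ∂(Measure.pi fun _ : Fin t => p)
        = ENNReal.ofReal (1 / N) := by simp
    rw [← hone, ← lintegral_indicator_one hSm]
    refine lintegral_le_of_lmarginal_le {j} (measurable_one.indicator hSm) measurable_const ?_
    rw [lmarginal_singleton, lmarginal_singleton]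
    intro x
    simp only [lintegral_const, measure_univ, mul_one]
    have hm := measurable_pi_apply (X := fun _ : Fin d => unitInterval) k
    set Q := {y | x i k ≠ y ∧ marginalCell p N k (x i k) = marginalCell p N k y} with hQ
    have hQm : MeasurableSet Q := (measurableSet_eq_fun measurable_const measurable_id).compl.inter
        (measurableSet_eq_fun measurable_const (hcm k))
    calc ∫⁻ y, S.indicator 1 (Function.update x j y) ∂p
        = ∫⁻ y, ((fun a : Fin d → unitInterval => a k) ⁻¹' Q).indicator 1 y ∂p := by
          refine lintegral_congr fun y => ?_
          have hmem : Function.update x j y ∈ S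
              ↔ y ∈ (fun a : Fin d → unitInterval => a k) ⁻¹' Q := by
            change _ ∧ _ ↔ _ ∧ _
            rw [Function.update_self, Function.update_of_ne hij]
          by_cases h : Function.update x j y ∈ S
          · rw [Set.indicator_of_mem h, Set.indicator_of_mem (hmem.1 h)]
            rfl
          · rw [Set.indicator_of_notMem h, Set.indicator_of_notMem fun h' => h (hmem.2 h')]
      _ = (p.map fun a => a k) Q := by
          rw [lintegral_indicator_one (hm hQm), Measure.map_apply hm hQm]
      _ ≤ _ := measure_quantileCell_eq_le _ N hN _
  have hsub : {x | CellCollision (marginalCell p N) x}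
      ⊆ ⋃ q : Fin t × Fin t × Fin d, {x : Fin t → Fin d → unitInterval | x q.1 q.2.2 ≠ x q.2.1 q.2.2
        ∧ marginalCell p N q.2.2 (x q.1 q.2.2) = marginalCell p N q.2.2 (x q.2.1 q.2.2)} := by
    rintro x ⟨i, j, k, h⟩
    exact Set.mem_iUnion.2 ⟨(i, j, k), h⟩
  refine (measure_mono hsub).trans ((measure_iUnion_fintype_le _ _).trans ?_)
  refine (Finset.sum_le_sum fun q _ => pair q.1 q.2.1 q.2.2).trans (le_of_eq ?_)
  rw [Finset.sum_const, Finset.card_univ, Fintype.card_prod, Fintype.card_prod, Fintype.card_fin,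
    Fintype.card_fin, nsmul_eq_mul, ← ENNReal.ofReal_natCast, ← ENNReal.ofReal_mul (by positivity)]
  congr 1
  push_cast
  ring

end Cells

/-! ### Dyadic encoding of boxes -/

section Dyadic

/-- The value at level `l` and position `m` of the dyadic encoding of the point `c`: the indicator
of `c` lying in the `m`-th dyadic interval of length `2 ^ l`. -/
def dyadicPoint (c l m : ℕ) : ℝ := if c / 2 ^ l = m then 1 else 0

/-- The value at level `l` and position `m` of the dyadic encoding of the initial segment `[0, r)`:
the indicator of the `m`-th dyadic interval of length `2 ^ l` occurring in the decomposition of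
`[0, r)` given by the binary digits of `r`. -/
def dyadicSegment (r l m : ℕ) : ℝ := if (r / 2 ^ l) % 2 = 1 ∧ r / 2 ^ l = m + 1 then 1 else 0

/-- The binary digits of `r` decompose `[0, r)` into disjoint dyadic intervals, so that exactly one
of them contains a given `c < r`. -/
lemma sum_dyadic_levels (L c r : ℕ) (hc : c < 2 ^ L) (hr : r < 2 ^ L) :
    ∑ l ∈ Finset.range L, (if (r / 2 ^ l) % 2 = 1 ∧ r / 2 ^ l = c / 2 ^ l + 1 then (1 : ℝ) else 0)
      = if c < r then 1 else 0 := by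
  induction L generalizing c r with
  | zero =>
    have : ¬ c < r := by omega
    simp [this]
  | succ L ih =>
    rw [Finset.sum_range_succ']
    have h := ih (c / 2) (r / 2) (by omega) (by omega)
    simp only [Nat.div_div_eq_div_mul, ← pow_succ'] at h
    rw [h]
    simp only [pow_zero, Nat.div_one]
    split_ifs <;> first | omega | norm_num

/-- The inner product of the encodings of a point and of an initial segment tells whether the point
lies in the segment. -/
lemma sum_dyadicPoint_mul_dyadicSegment {L c r : ℕ} (hc : c < 2 ^ L) (hr : r < 2 ^ L) :
    ∑ q : Fin L × Fin (2 ^ L), dyadicPoint c q.1 q.2 * dyadicSegment r q.1 q.2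
      = if c < r then 1 else 0 := by
  rw [← sum_dyadic_levels L c r hc hr, Fintype.sum_prod_type,
    Finset.sum_range
      (fun l => if (r / 2 ^ l) % 2 = 1 ∧ r / 2 ^ l = c / 2 ^ l + 1 then (1 : ℝ) else 0)]
  refine Finset.sum_congr rfl fun l _ => ?_
  have hlt : c / 2 ^ (l : ℕ) < 2 ^ L := (Nat.div_le_self _ _).trans_lt hc
  rw [Finset.sum_eq_single (⟨c / 2 ^ (l : ℕ), hlt⟩ : Fin (2 ^ L))]
  · simp [dyadicPoint, dyadicSegment]
  · intro m _ hm
    have : c / 2 ^ (l : ℕ) ≠ m := fun h => hm (Fin.ext h.symm)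
    simp [dyadicPoint, this]
  · simp

/-- A sum over levels and positions is at most the number of levels times a bound for the sums over
the positions. -/
lemma sum_levels_le {L n : ℕ} (f : Fin L → Fin n → ℝ) {B : ℝ} (h : ∀ l, ∑ m, f l m ≤ B) :
    ∑ q : Fin L × Fin n, f q.1 q.2 ≤ B * L := by
  rw [Fintype.sum_prod_type]
  refine (Finset.sum_le_sum fun l _ => h l).trans (le_of_eq ?_)
  simp [mul_comm]

lemma sum_dyadicPoint_sq_le (L c : ℕ) :
    ∑ q : Fin L × Fin (2 ^ L), dyadicPoint c q.1 q.2 ^ 2 ≤ L := by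
  refine (sum_levels_le (fun l m => dyadicPoint c l m ^ 2) (B := 1) fun l => ?_).trans (by simp)
  simp only [dyadicPoint, ite_pow, one_pow, ne_eq, OfNat.ofNat_ne_zero, not_false_eq_true, zero_pow]
  rw [Finset.sum_boole]
  norm_cast
  refine Finset.card_le_one.2 fun a ha b hb => ?_
  simp only [Finset.mem_filter] at ha hb
  exact Fin.ext (ha.2.symm.trans hb.2)

lemma sum_dyadicSegment_sq_le (L r : ℕ) :
    ∑ q : Fin L × Fin (2 ^ L), dyadicSegment r q.1 q.2 ^ 2 ≤ L := by
  refine (sum_levels_le (fun l m => dyadicSegment r l m ^ 2) (B := 1) fun l => ?_).trans (by simp)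
  simp only [dyadicSegment, ite_pow, one_pow, ne_eq, OfNat.ofNat_ne_zero, not_false_eq_true,
    zero_pow]
  rw [Finset.sum_boole]
  norm_cast
  refine Finset.card_le_one.2 fun a ha b hb => ?_
  simp only [Finset.mem_filter] at ha hb
  exact Fin.ext (by omega)

variable {d : ℕ}

/-- The space of the dyadic encodings in dimension `d`, a tensor power of the one-dimensional one:
there is one coordinate for every choice of a level and a position in each direction. -/
abbrev DyadicSpace (d L : ℕ) := EuclideanSpace ℝ (Fin d → Fin L × Fin (2 ^ L))

/-- The encoding of a point with the integer coordinates `c`. -/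
noncomputable def pointVector (L : ℕ) (c : Fin d → ℕ) : DyadicSpace d L :=
  WithLp.toLp 2 fun q => ∏ k, dyadicPoint (c k) (q k).1 (q k).2

/-- The encoding of the box of the integer points with `l k ≤ c k < r k` for all `k`. -/
noncomputable def boxVector (L : ℕ) (l r : Fin d → ℕ) : DyadicSpace d L :=
  WithLp.toLp 2 fun q => ∏ k, (dyadicSegment (r k) (q k).1 (q k).2
    - dyadicSegment (l k) (q k).1 (q k).2)

lemma inner_pointVector_boxVector {L : ℕ} {c l r : Fin d → ℕ} (hc : ∀ k, c k < 2 ^ L)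
    (hlr : ∀ k, l k ≤ r k) (hr : ∀ k, r k < 2 ^ L) :
    inner ℝ (pointVector L c) (boxVector L l r)
      = if ∀ k, l k ≤ c k ∧ c k < r k then 1 else 0 := by
  have h1 : ∀ k, ∑ q : Fin L × Fin (2 ^ L), dyadicPoint (c k) q.1 q.2
      * (dyadicSegment (r k) q.1 q.2 - dyadicSegment (l k) q.1 q.2)
      = if l k ≤ c k ∧ c k < r k then 1 else 0 := fun k => by
    simp only [mul_sub, Finset.sum_sub_distrib]
    rw [sum_dyadicPoint_mul_dyadicSegment (hc k) (hr k),
      sum_dyadicPoint_mul_dyadicSegment (hc k) ((hlr k).trans_lt (hr k))]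
    have := hlr k
    split_ifs <;> first | omega | norm_num
  have h2 : inner ℝ (pointVector L c) (boxVector L l r)
      = ∑ q : Fin d → Fin L × Fin (2 ^ L), ∏ k, dyadicPoint (c k) (q k).1 (q k).2
      * (dyadicSegment (r k) (q k).1 (q k).2 - dyadicSegment (l k) (q k).1 (q k).2) := by
    rw [PiLp.inner_apply]
    refine Finset.sum_congr rfl fun q _ => ?_
    simp only [pointVector, boxVector, RCLike.inner_apply, conj_trivial, Finset.prod_mul_distrib]
    ring
  rw [h2, ← Fintype.piFinset_univ, ← Finset.prod_univ_sum (fun _ => Finset.univ)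
    (fun k (q : Fin L × Fin (2 ^ L)) => dyadicPoint (c k) q.1 q.2
      * (dyadicSegment (r k) q.1 q.2 - dyadicSegment (l k) q.1 q.2))]
  simp only [h1]
  split_ifs with h
  · exact Finset.prod_eq_one fun k _ => if_pos (h k)
  · obtain ⟨k, hk⟩ := not_forall.1 h
    exact Finset.prod_eq_zero (Finset.mem_univ k) (if_neg hk)

lemma norm_sq_tensor_le {L : ℕ} (f : Fin d → Fin L × Fin (2 ^ L) → ℝ) {B : ℝ}
    (hf : ∀ k, ∑ q, f k q ^ 2 ≤ B) :
    ‖(WithLp.toLp 2 fun q => ∏ k, f k (q k) : DyadicSpace d L)‖ ^ 2 ≤ B ^ d := by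
  rw [EuclideanSpace.norm_sq_eq]
  simp only [Real.norm_eq_abs, sq_abs, ← Finset.prod_pow]
  rw [← Fintype.piFinset_univ, ← Finset.prod_univ_sum (fun _ => Finset.univ) (fun k q => f k q ^ 2)]
  refine (Finset.prod_le_prod (fun k _ => Finset.sum_nonneg fun q _ => sq_nonneg _)
    fun k _ => hf k).trans (by simp)

lemma norm_sq_pointVector_le (L : ℕ) (c : Fin d → ℕ) : ‖pointVector L c‖ ^ 2 ≤ (L : ℝ) ^ d :=
  norm_sq_tensor_le (fun k q => dyadicPoint (c k) q.1 q.2) fun k => sum_dyadicPoint_sq_le L (c k)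

lemma norm_sq_boxVector_le (L : ℕ) (l r : Fin d → ℕ) :
    ‖boxVector L l r‖ ^ 2 ≤ (4 * L : ℝ) ^ d := by
  refine norm_sq_tensor_le
    (fun k q => dyadicSegment (r k) q.1 q.2 - dyadicSegment (l k) q.1 q.2) fun k => ?_
  calc ∑ q : Fin L × Fin (2 ^ L), (dyadicSegment (r k) q.1 q.2 - dyadicSegment (l k) q.1 q.2) ^ 2
      ≤ ∑ q : Fin L × Fin (2 ^ L), (2 * dyadicSegment (r k) q.1 q.2 ^ 2
        + 2 * dyadicSegment (l k) q.1 q.2 ^ 2) := by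
        refine Finset.sum_le_sum fun q _ => ?_
        nlinarith [sq_nonneg (dyadicSegment (r k) q.1 q.2 + dyadicSegment (l k) q.1 q.2)]
    _ ≤ 4 * L := by
        rw [Finset.sum_add_distrib, ← Finset.mul_sum, ← Finset.mul_sum]
        linarith [sum_dyadicSegment_sq_le L (r k), sum_dyadicSegment_sq_le L (l k)]

end Dyadic

/-! ### The algorithm and its analysis -/

section Signing

open scoped RealInnerProductSpace

variable {d t : ℕ}

/-- The dyadic encodings of the points `x`, computed from the labels of their coordinates. -/
noncomputable def encode (cell : Fin d → unitInterval → ℕ) (L : ℕ)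
    (x : Fin t → Fin d → unitInterval) (j : Fin t) : DyadicSpace d L :=
  pointVector L fun k => cell k (x j k)

lemma measurable_encode {cell : Fin d → unitInterval → ℕ} (hcell : ∀ k, Monotone (cell k)) (L : ℕ) :
    Measurable (encode (t := t) cell L) := by
  refine measurable_pi_iff.2 fun j => ?_
  have h : Measurable fun x : Fin t → Fin d → unitInterval => fun k => cell k (x j k) :=
    measurable_pi_iff.2 fun k => (hcell k).measurable.comp (by fun_prop)
  exact (measurable_of_countable (pointVector L)).comp h

/-- The online signing that runs the self-balancing walk on the dyadic encodings of the points. -/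
noncomputable def dyadicSigning (t : ℕ) (c : ℝ) (cell : Fin d → unitInterval → ℕ)
    (hcell : ∀ k, Monotone (cell k)) (L : ℕ) :
    OnlineSigning (Fin t → unitInterval) (Fin d → unitInterval) t where
  sign s x i := walkSign c s (encode cell L x) i
  sign_eq _ _ _ := balancedSign_eq _ _ _
  online s x y i h := by
    have hi : encode cell L x i = encode cell L y i := by rw [encode, encode, h i le_rfl]
    have hw : walk c s (encode cell L x) i = walk c s (encode cell L y) i :=
      walk_congr fun j hj => ⟨rfl, by rw [encode, encode, h j (Fin.le_def.2 hj.le)]⟩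
    rw [walkSign, walkSign, hi, hw]
  measurable_sign i := (measurable_walkSign c i).comp
    (measurable_fst.prodMk ((measurable_encode hcell L).comp measurable_snd))

/-- If the labels separate the points in every coordinate, the discrepancy of a box is the inner
product of the walk with the encoding of a box of labels. -/
lemma exists_prefixDisc_eq {c : ℝ} {cell : Fin d → unitInterval → ℕ}
    (hcell : ∀ k, Monotone (cell k)) {L M : ℕ} (hM : ∀ k a, cell k a < M) (hML : M < 2 ^ L)
    (s : Fin t → unitInterval) {x : Fin t → Fin d → unitInterval} (hx : ¬ CellCollision cell x)
    {B : Set (Fin d → unitInterval)} (hB : IsBox B) (i : Fin t) :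
    ∃ q : (Fin d → Fin (2 ^ L)) × (Fin d → Fin (2 ^ L)),
      prefixDisc ((dyadicSigning t c cell hcell L).sign s x) x B i
        = |⟪walk c s (encode cell L x) (i + 1),
            boxVector L (fun k => (q.1 k : ℕ)) (fun k => (q.2 k : ℕ))⟫| := by
  obtain ⟨I, hI, rfl⟩ := hB
  have hsep : ∀ k i j, cell k (x i k) = cell k (x j k) → x i k = x j k := fun k i j h => by
    by_contra hne
    exact hx ⟨i, j, k, hne, h⟩
  choose l r hlr hrM hmem using fun k =>
    exists_label_interval (X := fun j => x j k) (hcell k) (hM k) (hsep k) (hI k)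
  have hr : ∀ k, r k < 2 ^ L := fun k => (hrM k).trans_lt hML
  refine ⟨(fun k => ⟨l k, (hlr k).trans_lt (hr k)⟩, fun k => ⟨r k, hr k⟩), ?_⟩
  rw [walk_succ_eq_sum, sum_inner, prefixDisc]
  congr 1
  refine Finset.sum_congr rfl fun j _ => ?_
  rw [real_inner_smul_left]
  congr 1
  rw [encode, inner_pointVector_boxVector (fun k => (hM k _).trans hML) hlr hr]
  have hiff : x j ∈ Set.univ.pi I ↔ ∀ k, l k ≤ cell k (x j k) ∧ cell k (x j k) < r k := by
    simp only [Set.mem_univ_pi, hmem]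
  by_cases h : x j ∈ Set.univ.pi I
  · rw [Set.indicator_of_mem h, if_pos (hiff.1 h)]
  · rw [Set.indicator_of_notMem h, if_neg fun h' => h (hiff.2 h')]

/-- The failure probability of the algorithm, before the parameters are chosen: the first term
accounts for two points sharing a quantile cell, the second one for the walk leaving the region where
its bias is a genuine probability, the last one for a large discrepancy of one of the boxes of
labels. -/
theorem measure_prefixDisc_large_le (p : Measure (Fin d → unitInterval)) [IsProbabilityMeasure p]
    {N L : ℕ} (hN : 0 < N) (hL : 0 < L) (hNL : 2 * N + 1 < 2 ^ L) {c τ : ℝ} (hc : 0 < c)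
    (hLc : (L : ℝ) ^ d ≤ c) (hτ : 0 ≤ τ) :
    ((Measure.pi fun _ : Fin t => (volume : Measure unitInterval)).prod
        (Measure.pi fun _ : Fin t => p))
        {q | ¬ ∀ (i : Fin t) (B : Set (Fin d → unitInterval)), IsBox B →
          prefixDisc ((dyadicSigning t c (marginalCell p N) (marginalCell_mono N p) L).sign q.1 q.2)
            q.2 B i ≤ τ}
      ≤ ENNReal.ofReal (d * t ^ 2 / N + (t * (2 * Real.exp (-(c / (2 * (L : ℝ) ^ d))))
        + t * ((2 ^ L) ^ d * (2 ^ L) ^ d)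
          * (2 * Real.exp (-(τ ^ 2 / (2 * c * (4 * L : ℝ) ^ d)))))) := by
  have hcell := marginalCell_mono N p
  have hM : ∀ k a, marginalCell p N k a < 2 * N + 1 := fun k a =>
    Nat.lt_succ_of_le (marginalCell_le N p k a)
  set cell := marginalCell p N
  set box : (Fin d → Fin (2 ^ L)) × (Fin d → Fin (2 ^ L)) → DyadicSpace d L := fun q =>
    boxVector L (fun k => (q.1 k : ℕ)) (fun k => (q.2 k : ℕ)) with hbox
  set E : Set ((Fin t → unitInterval) × (Fin t → Fin d → unitInterval)) :=
    {q | ∃ (i : Fin t) (k : (Fin d → Fin (2 ^ L)) × (Fin d → Fin (2 ^ L))),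
      τ < |⟪walk c q.1 (encode cell L q.2) (i + 1), box k⟫|} with hE
  have hEm : MeasurableSet E := by
    have : E = ⋃ (i : Fin t) (k : (Fin d → Fin (2 ^ L)) × (Fin d → Fin (2 ^ L))),
        {q | τ < |⟪walk c q.1 (encode cell L q.2) (i + 1), box k⟫|} := by
      ext q; simp [hE]
    rw [this]
    refine MeasurableSet.iUnion fun i => MeasurableSet.iUnion fun k => ?_
    have h : Measurable fun q : (Fin t → unitInterval) × (Fin t → Fin d → unitInterval) =>
        walk c q.1 (encode cell L q.2) (i + 1) :=
      (measurable_walk c (i + 1)).comp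
        (measurable_fst.prodMk ((measurable_encode hcell L).comp measurable_snd))
    exact measurableSet_lt measurable_const (h.inner measurable_const).abs
  have hsub : {q : (Fin t → unitInterval) × (Fin t → Fin d → unitInterval) |
      ¬ ∀ (i : Fin t) (B : Set (Fin d → unitInterval)), IsBox B →
        prefixDisc ((dyadicSigning t c cell hcell L).sign q.1 q.2) q.2 B i ≤ τ}
      ⊆ Set.univ ×ˢ {x | CellCollision cell x} ∪ E := by
    intro q hq
    by_cases hx : CellCollision cell q.2
    · exact Or.inl ⟨trivial, hx⟩
    · right
      by_contra hcon
      refine hq fun i B hB => ?_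
      obtain ⟨k, hk⟩ := exists_prefixDisc_eq (c := c) hcell hM hNL q.1 hx hB i
      rw [hk]
      by_contra hlt
      exact hcon ⟨i, k, not_le.1 hlt⟩
  refine (measure_mono hsub).trans ((measure_union_le _ _).trans ?_)
  rw [ENNReal.ofReal_add (by positivity) (by positivity)]
  refine add_le_add ?_ ?_
  · rw [Measure.prod_prod, measure_univ, one_mul]
    exact measure_cellCollision_le N p hN
  · rw [Measure.prod_apply_symm hEm]
    have hL' : (0 : ℝ) < L := by exact_mod_cast hL
    have hcard : (Fintype.card ((Fin d → Fin (2 ^ L)) × (Fin d → Fin (2 ^ L))) : ℝ)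
        = (2 ^ L) ^ d * (2 ^ L) ^ d := by
      simp [Fintype.card_prod]
    rw [← hcard]
    refine (lintegral_mono fun x => measure_exists_walk_large_le hc (encode cell L x) box
      (U := (4 * L : ℝ) ^ d) (V := (L : ℝ) ^ d) (by positivity) hLc
      (fun i => norm_sq_pointVector_le L _) (by positivity)
      (fun k => norm_sq_boxVector_le L _ _) hτ).trans (le_of_eq ?_)
    rw [lintegral_const, measure_univ, mul_one]

end Signing

/-! ### Choice of the parameters -/

section Parameters

/-- Bounds for the mesh `1/N` of the quantile cells and the number `L` of dyadic levels. -/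
lemma exists_mesh_levels {D T δ : ℝ} (hD : 1 ≤ D) (hT : 1 ≤ T) (hδ : 0 < δ) (hδ1 : δ < 1)
    (hR : 2 ≤ D * T / δ) :
    ∃ N L : ℕ, 0 < N ∧ 0 < L ∧ 2 * N + 1 < 2 ^ L ∧ D * T ^ 2 / N ≤ δ / 2 ∧
      (2 : ℝ) ^ L ≤ (D * T / δ) ^ 6 ∧ (L : ℝ) ≤ 9 * Real.log (D * T / δ) := by
  set R := D * T / δ with hRdef
  set a := 2 * D * T ^ 2 / δ with ha
  have ha0 : 0 < a := by positivity
  have haR : a ≤ 2 * R ^ 2 := by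
    have h1 : a = 2 * R * T := by rw [ha, hRdef]; field_simp
    have h2 : T ≤ R := by
      rw [hRdef, le_div_iff₀ hδ]
      nlinarith
    rw [h1, pow_two]
    nlinarith
  set N := ⌈a⌉₊ with hN
  have hN0 : 0 < N := Nat.ceil_pos.2 ha0
  have hNa : a ≤ N := Nat.le_ceil a
  have hNa' : (N : ℝ) < a + 1 := Nat.ceil_lt_add_one ha0.le
  set L := Nat.log 2 (2 * N + 1) + 1 with hL
  have hpow : (2 : ℝ) ^ L ≤ R ^ 6 := by
    have h1 : 2 ^ Nat.log 2 (2 * N + 1) ≤ 2 * N + 1 := Nat.pow_log_le_self 2 (by omega)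
    have h2 : (2 : ℝ) ^ Nat.log 2 (2 * N + 1) ≤ 2 * N + 1 := by exact_mod_cast h1
    have h4 : (2 : ℝ) ^ 2 ≤ R ^ 2 := by gcongr
    have h5 : (2 : ℝ) ^ 4 ≤ R ^ 4 := by gcongr
    calc (2 : ℝ) ^ L = 2 * 2 ^ Nat.log 2 (2 * N + 1) := by rw [hL, pow_succ]; ring
      _ ≤ 2 ^ 4 * R ^ 2 := by nlinarith
      _ ≤ R ^ 4 * R ^ 2 := by gcongr
      _ = R ^ 6 := by ring
  refine ⟨N, L, hN0, Nat.succ_pos _, Nat.lt_pow_succ_log_self (by norm_num) _, ?_, hpow, ?_⟩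
  · rw [div_le_iff₀ (by exact_mod_cast hN0)]
    have : D * T ^ 2 = δ / 2 * a := by rw [ha]; field_simp
    rw [this]
    gcongr
  · have h := Real.log_le_log (by positivity) hpow
    rw [Real.log_pow, Real.log_pow] at h
    have h2 := Real.log_two_gt_d9
    have hL0 : (0 : ℝ) ≤ L := Nat.cast_nonneg _
    push_cast at h
    nlinarith

/-- With threshold `8 L ^ d log R` for the walk and a discrepancy bound of order
`log R ^ (d + 1)`, the walk contributes at most `δ / 2` to the failure probability. -/
lemma walk_failure_le {d L : ℕ} {D T δ : ℝ} (hD : 1 ≤ D) (hT : 1 ≤ T) (hδ : 0 < δ) (hL : 0 < L)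
    (hR : 2 ≤ D * T / δ) (hpow : (2 : ℝ) ^ L ≤ (D * T / δ) ^ 6)
    (hlog : (L : ℝ) ≤ 9 * Real.log (D * T / δ)) :
    T * (2 * Real.exp (-(8 * (L : ℝ) ^ d * Real.log (D * T / δ) / (2 * (L : ℝ) ^ d))))
        + T * ((2 ^ L) ^ d * (2 ^ L) ^ d)
          * (2 * Real.exp (-((4 * 18 ^ d * (12 * d + 4) * Real.log (D * T / δ) ^ (d + 1)) ^ 2
            / (2 * (8 * (L : ℝ) ^ d * Real.log (D * T / δ)) * (4 * L : ℝ) ^ d)))) ≤ δ / 2 := by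
  set R := D * T / δ with hRdef
  have hR0 : 0 < R := by linarith
  set ℓ := Real.log R with hℓ
  have hL0 : (0 : ℝ) < L := by exact_mod_cast hL
  have hℓ0 : 0 < ℓ := Real.log_pos (by linarith)
  have hexp : ∀ m : ℕ, Real.exp (-(m * ℓ)) = (R ^ m)⁻¹ := fun m => by
    rw [Real.exp_neg, mul_comm, Real.exp_mul, hℓ, Real.exp_log hR0, Real.rpow_natCast]
  have hTR : T ≤ δ * R := by
    rw [hRdef, mul_div_cancel₀ _ hδ.ne']
    nlinarith
  have hR3 : (2 : ℝ) ^ 3 ≤ R ^ 3 := by gcongr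
  -- the common estimate: eight times `T` is at most `δ` times the fourth power of `R`
  have main : T * (2 * (R ^ 4)⁻¹) ≤ δ / 4 := by
    rw [← mul_assoc, ← div_eq_mul_inv, div_le_iff₀ (by positivity)]
    have : δ * R * 2 ^ 3 ≤ δ * R * R ^ 3 := by gcongr
    nlinarith
  have e1 : 8 * (L : ℝ) ^ d * ℓ / (2 * (L : ℝ) ^ d) = (4 : ℕ) * ℓ := by
    push_cast
    field_simp
    norm_num
  have e2 : ((12 * d + 4 : ℕ) : ℝ) * ℓ ≤ (4 * 18 ^ d * (12 * d + 4) * ℓ ^ (d + 1)) ^ 2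
      / (2 * (8 * (L : ℝ) ^ d * ℓ) * (4 * L : ℝ) ^ d) := by
    rw [le_div_iff₀ (by positivity)]
    have hLd : (L : ℝ) ^ d ≤ (9 * ℓ) ^ d := by gcongr
    have h4 : (4 * L : ℝ) ^ d ≤ (4 * (9 * ℓ)) ^ d := by gcongr
    have hone : (1 : ℝ) ≤ 12 * d + 4 := by
      have : (0 : ℝ) ≤ d := Nat.cast_nonneg d
      linarith
    calc ((12 * d + 4 : ℕ) : ℝ) * ℓ * (2 * (8 * (L : ℝ) ^ d * ℓ) * (4 * L : ℝ) ^ d)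
        ≤ ((12 * d + 4 : ℕ) : ℝ) * ℓ * (2 * (8 * (9 * ℓ) ^ d * ℓ) * (4 * (9 * ℓ)) ^ d) := by gcongr
      _ = (4 * 18 ^ d * ℓ ^ (d + 1)) ^ 2 * (12 * d + 4) * 1 := by
          have h18 : (18 : ℝ) ^ d = 9 ^ d * 2 ^ d := by rw [← mul_pow]; norm_num
          have h4' : (4 : ℝ) ^ d = 2 ^ d * 2 ^ d := by rw [← mul_pow]; norm_num
          simp only [mul_pow, h18, h4']
          push_cast
          ring
      _ ≤ (4 * 18 ^ d * ℓ ^ (d + 1)) ^ 2 * (12 * d + 4) * (12 * d + 4) := by gcongr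
      _ = (4 * 18 ^ d * (12 * d + 4) * ℓ ^ (d + 1)) ^ 2 := by ring
  have f1 : T * (2 * Real.exp (-(8 * (L : ℝ) ^ d * ℓ / (2 * (L : ℝ) ^ d)))) ≤ δ / 4 := by
    rw [e1, hexp]
    exact main
  have f2 : T * ((2 ^ L) ^ d * (2 ^ L) ^ d)
      * (2 * Real.exp (-((4 * 18 ^ d * (12 * d + 4) * ℓ ^ (d + 1)) ^ 2
        / (2 * (8 * (L : ℝ) ^ d * ℓ) * (4 * L : ℝ) ^ d)))) ≤ δ / 4 := by
    calc _ ≤ T * ((R ^ 6) ^ d * (R ^ 6) ^ d) * (2 * Real.exp (-(((12 * d + 4 : ℕ) : ℝ) * ℓ))) := by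
          gcongr
      _ = T * (2 * (R ^ 4)⁻¹) := by
          rw [hexp]
          have : R ^ (12 * d + 4) = (R ^ 6) ^ d * (R ^ 6) ^ d * R ^ 4 := by ring
          rw [this]
          field_simp
      _ ≤ δ / 4 := main
  linarith

end Parameters

theorem theorem3p2 (d : ℕ) (hd : 1 ≤ d) :
    ∃ C : ℝ, 0 < C ∧
      ∀ (t : ℕ) (δ : ℝ), 1 ≤ t → 0 < δ → δ < 1 → 2 ≤ (d * t : ℝ) / δ →
      ∀ (p : Measure (Fin d → unitInterval)) [IsProbabilityMeasure p],
      ∃ (Ω : Type) (_ : MeasurableSpace Ω) (ρ : Measure Ω) (_ : IsProbabilityMeasure ρ)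
        (A : OnlineSigning Ω (Fin d → unitInterval) t),
        (ρ.prod (Measure.pi fun _ : Fin t => p))
          {q | ¬ ∀ (i : Fin t) (B : Set (Fin d → unitInterval)), IsBox B →
            prefixDisc (A.sign q.1 q.2) q.2 B i ≤ C * Real.log ((d * t : ℝ) / δ) ^ (d + 1)}
          ≤ ENNReal.ofReal δ := by
  refine ⟨4 * 18 ^ d * (12 * d + 4), by positivity, fun t δ ht hδ hδ1 hR p _ => ?_⟩
  have hD : (1 : ℝ) ≤ d := by exact_mod_cast hd
  have hT : (1 : ℝ) ≤ t := by exact_mod_cast ht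
  obtain ⟨N, L, hN, hL, hNL, hcoll, hpow, hlog⟩ := exists_mesh_levels hD hT hδ hδ1 hR
  have hL0 : (0 : ℝ) < L := by exact_mod_cast hL
  have hℓ : Real.log 2 ≤ Real.log ((d * t : ℝ) / δ) := Real.log_le_log (by norm_num) hR
  have hlog2 := Real.log_two_gt_d9
  have hℓ0 : 0 < Real.log ((d * t : ℝ) / δ) := by linarith
  -- the threshold of the walk exceeds the squared norm `L ^ d` of the encoded points
  have hLc : (L : ℝ) ^ d ≤ 8 * (L : ℝ) ^ d * Real.log ((d * t : ℝ) / δ) := by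
    have : (0 : ℝ) < (L : ℝ) ^ d := by positivity
    nlinarith
  refine ⟨Fin t → unitInterval, inferInstance, Measure.pi fun _ => volume, inferInstance,
    dyadicSigning t (8 * (L : ℝ) ^ d * Real.log ((d * t : ℝ) / δ)) _
      (marginalCell_mono N p) L, ?_⟩
  refine (measure_prefixDisc_large_le p hN hL hNL (by positivity) hLc (by positivity)).trans ?_
  refine ENNReal.ofReal_le_ofReal ?_
  have := walk_failure_le (d := d) hD hT hδ hL hR hpow hlog
  linarith
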